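/- Let $n\ge 1$ and let $W_1,\dots,W_{n^2}$ be linearly independent density matrices on $\mathbb{C}^{n}$ (positive semidefinite, trace one), regarded as a classical-quantum channel $W$ with input alphabet $\mathcal{X}=\{1,\dots,n^2\}$. Write $H(\rho)=-\operatorname{Tr}\rho\log\rho$ for the von Neumann entropy, $D(\rho\|\sigma)=\operatorname{Tr}\rho(\log\rho-\log\sigma)$ for the quantum relative entropy (equal to $+\infty$ if $\ker\sigma\not\subset\ker\rho$), and $$C_q(W)=\max_{P}\sum_{x\in\mathcal{X}}P(x)\,D\Big(W_x\Big\|\sum_{x'\in\mathcal{X}}P(x')W_{x'}\Big),$$ where $P$ runs over the probability distributions on $\mathcal{X}$ (and $0\cdot\infty=0$). Let $A_1,\dots,A_{n^2-1}$ be linearly independent Hermitian matrices on $\mathbb{C}^n$ with $\operatorname{Tr}W_{n^2}A_j=0$ for all $j$. For $\theta\in\mathbb{R}^{n^2-1}$ put $$\phi(\theta)=\log\operatorname{Tr}\exp\Big(\sum_{j=1}^{n^2-1}\theta^jA_j\Big),\qquad \rho_\theta=\exp\Big(\sum_{j=1}^{n^2-1}\theta^jA_j-\phi(\theta)I\Big).$$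 Suppose that $\theta$ satisfies $$\sum_{j=1}^{n^2-1}\operatorname{Tr}(W_iA_j)\,\theta^j=-H(W_i)+H(W_{n^2})\qquad(i=1,\dots,n^2).$$ Then $\rho_\theta$ is a density matrix and $$D(W_x\|\rho_\theta)=\phi(\theta)-H(W_{n^2})\qquad\text{for every }x\in\mathcal{X}.$$ Moreover, there is exactly one function $\hat Q_{X,*}:\mathcal{X}\to\mathbb{R}$ with $\sum_{x\in\mathcal{X}}\hat Q_{X,*}(x)W_x=\rho_\theta$. If $\hat Q_{X,*}(x)\ge 0$ for every $x\in\mathcal{X}$, then $\hat Q_{X,*}$ is a probability distribution that attains the maximum in the definition of $C_q(W)$, and $$C_q(W)=\phi(\theta)-H(W_{n^2}).$$ -/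

import Mathlib

namespace CQ

open Matrix
open scoped ComplexOrder

noncomputable section

variable {d : Type*} [Fintype d] [DecidableEq d]

/-- A density matrix on `ℂ^d`: positive semidefinite with unit trace. -/
def IsDensityMatrix (ρ : Matrix d d ℂ) : Prop :=
  ρ.PosSemidef ∧ ρ.trace = 1

/-- The logarithm (base `e`) of a Hermitian matrix by functional calculus. As `Real.log 0 = 0`, it
vanishes on the kernel, which is the convention `0 log 0 = 0` in the traces below. -/
def matLog (ρ : Matrix d d ℂ) : Matrix d d ℂ :=
  cfc Real.log ρ

/-- The von Neumann entropy `H(ρ) = -Tr ρ log ρ`. -/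
def entropy (ρ : Matrix d d ℂ) : ℝ :=
  -(ρ * matLog ρ).trace.re

open scoped Classical in
/-- The quantum relative entropy `D(ρ‖σ) = Tr ρ (log ρ - log σ)`, equal to `+∞` when the kernel of
`σ` is not contained in the kernel of `ρ`. -/
def relEntropy (ρ σ : Matrix d d ℂ) : EReal :=
  if ∀ v : d → ℂ, σ *ᵥ v = 0 → ρ *ᵥ v = 0 then
    (((ρ * (matLog ρ - matLog σ)).trace.re : ℝ) : EReal)
  else ⊤

/-- The output matrix `∑ x, P x W_x`. -/
def output {X : Type*} [Fintype X] (W : X → Matrix d d ℂ) (P : X → ℝ) : Matrix d d ℂ :=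
  ∑ x, P x • W x

/-- `∑ x, P x D(W_x ‖ ∑ x', P x' W_x')`; in `EReal`, `0 * ⊤ = 0`. -/
def holevoInformation {X : Type*} [Fintype X] (W : X → Matrix d d ℂ) (P : X → ℝ) : EReal :=
  ∑ x, (P x : EReal) * relEntropy (W x) (output W P)

/-- The capacity of the classical-quantum channel `W`: the supremum, over the probability
distributions `P` on the input alphabet, of `holevoInformation W P`. -/
def capacity {X : Type*} [Fintype X] (W : X → Matrix d d ℂ) : EReal :=
  sSup (holevoInformation W '' stdSimplex ℝ X)

variable {J : Type*} [Fintype J]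

/-- `φ(θ) = log Tr exp (∑ j, θ j A_j)`. -/
def phi (A : J → Matrix d d ℂ) (θ : J → ℝ) : ℝ :=
  Real.log (NormedSpace.exp (∑ j, θ j • A j)).trace.re

/-- The Gibbs state `ρ_θ = exp (∑ j, θ j A_j - φ(θ))`. -/
def gibbs (A : J → Matrix d d ℂ) (θ : J → ℝ) : Matrix d d ℂ :=
  NormedSpace.exp (∑ j, θ j • A j - phi A θ • (1 : Matrix d d ℂ))

/-- The last element of the input alphabet `{1, …, n²}`. -/
def lastInput (n : ℕ) (hn : 0 < n) : Fin (n ^ 2) :=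
  ⟨n ^ 2 - 1, Nat.sub_lt (pow_pos hn 2) one_pos⟩

end

end CQ

namespace CQ

open Matrix
open scoped ComplexOrder

set_option linter.unusedSectionVars false

noncomputable section

variable {d : Type*} [Fintype d] [DecidableEq d]

/-! As `log ρ_θ = ∑ θ^j A_j - φ(θ)`, the divergence `D(W_x‖ρ_θ)` is `φ(θ) - H(W_x) - ∑ θ^j Tr W_x
A_j`, and the linear system for `θ` is exactly what makes this a constant `C` (`relEntropy_gibbs`).
For any `P` with output `W_P` and any positive definite state `ρ`, `∑ P(x) D(W_x‖W_P) = ∑ P(x)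
D(W_x‖ρ) - D(W_P‖ρ)`. With `ρ = ρ_θ` and the Klein inequality this is at most `C`
(`holevoInformation_le`), with equality if `W_P = ρ_θ`. The weights producing `ρ_θ` exist and are
unique because `n²` independent Hermitian matrices form a real basis of the Hermitian matrices
(`exists_output_eq`, `output_injective`). -/

lemma IsDensityMatrix.isHermitian {ρ : Matrix d d ℂ} (hρ : IsDensityMatrix ρ) : ρ.IsHermitian :=
  hρ.1.isHermitian

section FunctionalCalculus

/-- The weights `|⟨u_i, v_j⟩|²` of two eigenbases. -/
def overlap {σ ρ : Matrix d d ℂ} (hσ : σ.IsHermitian) (hρ : ρ.IsHermitian) (i j : d) : ℝ :=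
  Complex.normSq
    ((star (hσ.eigenvectorUnitary : Matrix d d ℂ) * (hρ.eigenvectorUnitary : Matrix d d ℂ)) i j)

lemma overlap_nonneg {σ ρ : Matrix d d ℂ} (hσ : σ.IsHermitian) (hρ : ρ.IsHermitian) (i j : d) :
    0 ≤ overlap hσ hρ i j :=
  Complex.normSq_nonneg _

lemma trace_diagonal_mul_mul_diagonal_mul_conjTranspose (a b : d → ℝ) (M : Matrix d d ℂ) :
    (diagonal (fun i => (a i : ℂ)) * M * diagonal (fun j => (b j : ℂ)) * Mᴴ).trace =
      ((∑ i, ∑ j, a i * b j * Complex.normSq (M i j) : ℝ) : ℂ) := by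
  simp only [trace, diag_apply, mul_apply (N := Mᴴ), mul_diagonal, diagonal_mul,
    conjTranspose_apply]
  push_cast
  refine Finset.sum_congr rfl fun i _ => Finset.sum_congr rfl fun j _ => ?_
  rw [Complex.normSq_eq_conj_mul_self, RCLike.star_def]
  ring

/-- Diagonalizing both matrices turns the trace into a double sum whose weights do not depend on `f`
and `g`, so trace inequalities reduce to scalar ones. -/
lemma trace_cfc_mul_cfc {σ ρ : Matrix d d ℂ} (hσ : σ.IsHermitian) (hρ : ρ.IsHermitian)
    (f g : ℝ → ℝ) :
    (cfc f σ * cfc g ρ).trace =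
      ((∑ i, ∑ j, f (hσ.eigenvalues i) * g (hρ.eigenvalues j) * overlap hσ hρ i j : ℝ) : ℂ) := by
  unfold overlap
  rw [hσ.cfc_eq, hρ.cfc_eq, ← trace_diagonal_mul_mul_diagonal_mul_conjTranspose,
    IsHermitian.cfc, IsHermitian.cfc, Unitary.conjStarAlgAut_apply, Unitary.conjStarAlgAut_apply,
    mul_assoc, mul_assoc, trace_mul_comm, conjTranspose_mul, star_eq_conjTranspose,
    conjTranspose_conjTranspose]
  simp only [mul_assoc, star_eq_conjTranspose]
  rfl

lemma continuousOn_spectrum (f : ℝ → ℝ) (σ : Matrix d d ℂ) : ContinuousOn f (spectrum ℝ σ) :=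
  finite_real_spectrum.continuousOn f

lemma matLog_exp {H : Matrix d d ℂ} (hH : H.IsHermitian) : matLog (NormedSpace.exp H) = H := by
  open scoped Matrix.Norms.L2Operator in
  exact CFC.log_exp H hH

lemma posDef_exp {H : Matrix d d ℂ} (hH : H.IsHermitian) : (NormedSpace.exp H).PosDef := by
  have h : (NormedSpace.exp H).PosSemidef := by
    open scoped Matrix.Norms.L2Operator MatrixOrder in
    exact nonneg_iff_posSemidef.mp (IsSelfAdjoint.exp_nonneg (A := Matrix d d ℂ) hH)
  exact h.posDef_iff_isUnit.mpr (isUnit_exp H)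

end FunctionalCalculus

section Klein

lemma sub_le_mul_log_sub_log {s r : ℝ} (hs : 0 ≤ s) (hr : 0 < r) :
    s - r ≤ s * (Real.log s - Real.log r) := by
  rcases hs.eq_or_lt with rfl | hs
  · simpa using hr.le
  · have h := Real.log_le_sub_one_of_pos (div_pos hr hs)
    rw [Real.log_div hr.ne' hs.ne'] at h
    have h2 := mul_le_mul_of_nonneg_left h hs.le
    rw [mul_sub s (r / s), mul_div_cancel₀ _ hs.ne'] at h2
    linarith

/-- **Klein inequality**: a lower bound for the unnormalized relative entropy. -/
lemma trace_sub_trace_le_trace_mul_matLog_sub {σ ρ : Matrix d d ℂ} (hσ : σ.PosSemidef)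
    (hρ : ρ.PosDef) :
    σ.trace.re - ρ.trace.re ≤ (σ * (matLog σ - matLog ρ)).trace.re := by
  have hσ' : IsSelfAdjoint σ := hσ.1
  have hρ' : IsSelfAdjoint ρ := hρ.1
  have t := fun f g => congrArg Complex.re (trace_cfc_mul_cfc hσ.1 hρ.1 f g)
  simp only [Complex.ofReal_re] at t
  -- Inserting the identity as `cfc 1` gives all four traces the same weights, so they can be
  -- compared term by term.
  have h1 : σ = cfc (fun x : ℝ => x) σ * cfc (fun _ : ℝ => 1) ρ := by
    rw [cfc_id' ℝ σ, cfc_const_one ℝ ρ, mul_one]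
  have h2 : ρ = cfc (fun _ : ℝ => 1) σ * cfc (fun x : ℝ => x) ρ := by
    rw [cfc_id' ℝ ρ, cfc_const_one ℝ σ, one_mul]
  have h3 : σ * matLog σ = cfc (fun x : ℝ => x * Real.log x) σ * cfc (fun _ : ℝ => 1) ρ := by
    rw [cfc_mul _ _ σ (continuousOn_spectrum _ _) (continuousOn_spectrum _ _), cfc_id' ℝ σ,
      cfc_const_one ℝ ρ, mul_one, matLog]
  have h4 : σ * matLog ρ = cfc (fun x : ℝ => x) σ * cfc Real.log ρ := by
    rw [cfc_id' ℝ σ, matLog]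
  rw [mul_sub, trace_sub, Complex.sub_re, h3, h4, t, t, congrArg (fun M => (trace M).re) h1,
    congrArg (fun M => (trace M).re) h2, t, t]
  simp only [← Finset.sum_sub_distrib]
  refine Finset.sum_le_sum fun i _ => Finset.sum_le_sum fun j _ => ?_
  have h := mul_le_mul_of_nonneg_right
    (sub_le_mul_log_sub_log (hσ.eigenvalues_nonneg i) (hρ.eigenvalues_pos j))
    (overlap_nonneg hσ.1 hρ.1 i j)
  linarith

end Klein

section Span

variable {X : Type*} [Fintype X]

lemma conjTranspose_sum_smul {m : Type*} {W : X → Matrix m m ℂ} (hW : ∀ x, (W x).IsHermitian) (c : X → ℂ) :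
    (∑ x, c x • W x)ᴴ = ∑ x, star (c x) • W x := by
  rw [conjTranspose_sum]
  exact Finset.sum_congr rfl fun x _ => by rw [conjTranspose_smul, (hW x).eq]

/-- A Hermitian combination is the average of itself and its adjoint, and averaging replaces each
coefficient by its real part. -/
lemma output_re {W : X → Matrix d d ℂ} (hW : ∀ x, (W x).IsHermitian) {c : X → ℂ}
    (hc : (∑ x, c x • W x).IsHermitian) :
    output W (fun x => (c x).re) = ∑ x, c x • W x := by
  have h : (2 : ℂ) • output W (fun x => (c x).re) = (2 : ℂ) • ∑ x, c x • W x := by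
    rw [two_smul ℂ (∑ x, c x • W x)]
    nth_rw 2 [← hc.eq]
    rw [conjTranspose_sum_smul hW, ← Finset.sum_add_distrib, output, Finset.smul_sum]
    refine Finset.sum_congr rfl fun x _ => ?_
    rw [← add_smul, RCLike.star_def, Complex.add_conj, ← Complex.coe_smul, smul_smul]
    push_cast
    rfl
  exact smul_right_injective _ (two_ne_zero' ℂ) h

lemma linearIndependent_complex {W : X → Matrix d d ℂ} (hW : ∀ x, (W x).IsHermitian)
    (hind : LinearIndependent ℝ W) : LinearIndependent ℂ W := by
  have key : ∀ c : X → ℂ, ∑ x, c x • W x = 0 → ∀ x, (c x).re = 0 := by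
    intro c hc
    refine Fintype.linearIndependent_iff.mp hind (fun x => (c x).re) ?_
    have h := output_re hW (c := c) (by rw [hc]; exact isHermitian_zero)
    rwa [hc] at h
  refine Fintype.linearIndependent_iff.mpr fun c hc x => Complex.ext (key c hc x) ?_
  -- Multiplying by `-i` moves imaginary parts into real parts.
  have h := key (fun x => -Complex.I * c x) (by
    simp_rw [mul_smul, ← Finset.smul_sum, hc, smul_zero]) x
  simpa using h

/-- Linearly independent Hermitian matrices, `(dim)²` in number, span the Hermitian matrices. -/
lemma exists_output_eq {W : X → Matrix d d ℂ} (hW : ∀ x, (W x).IsHermitian)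
    (hind : LinearIndependent ℝ W) (hcard : Fintype.card X = Fintype.card d ^ 2)
    {H : Matrix d d ℂ} (hH : H.IsHermitian) : ∃ Q : X → ℝ, output W Q = H := by
  have hspan := (linearIndependent_complex hW hind).span_eq_top_of_card_eq_finrank'
    (by rw [Module.finrank_matrix, Module.finrank_self, hcard]; ring)
  have hmem : H ∈ Submodule.span ℂ (Set.range W) := hspan ▸ Submodule.mem_top
  obtain ⟨c, rfl⟩ := (Submodule.mem_span_range_iff_exists_fun ℂ).mp hmem
  exact ⟨_, output_re hW hH⟩

lemma output_injective {m : Type*} {W : X → Matrix m m ℂ} (hind : LinearIndependent ℝ W) :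
    Function.Injective (output W) := fun P Q h => by
  have h0 : ∑ x, (P x - Q x) • W x = 0 := by
    simp_rw [sub_smul, Finset.sum_sub_distrib]
    exact sub_eq_zero.mpr h
  funext x
  exact sub_eq_zero.mp (Fintype.linearIndependent_iff.mp hind _ h0 x)

end Span

section Holevo

variable {X : Type*} [Fintype X]

lemma coe_sum (f : X → ℝ) : ((∑ x, f x : ℝ) : EReal) = ∑ x, (f x : EReal) :=
  map_sum (⟨⟨Real.toEReal, EReal.coe_zero⟩, EReal.coe_add⟩ : ℝ →+ EReal) f Finset.univ

lemma relEntropy_of_ker_le {ρ σ : Matrix d d ℂ} (h : ∀ v : d → ℂ, σ *ᵥ v = 0 → ρ *ᵥ v = 0) :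
    relEntropy ρ σ = (((ρ * (matLog ρ - matLog σ)).trace.re : ℝ) : EReal) :=
  if_pos h

lemma relEntropy_of_posDef (ρ : Matrix d d ℂ) {σ : Matrix d d ℂ} (hσ : σ.PosDef) :
    relEntropy ρ σ = (((ρ * (matLog ρ - matLog σ)).trace.re : ℝ) : EReal) := by
  refine relEntropy_of_ker_le fun v hv => ?_
  have hv0 : v = 0 := mulVec_injective_iff_isUnit.mpr hσ.isUnit (by rw [hv, mulVec_zero])
  rw [hv0, mulVec_zero]

lemma trace_output_mul (W : X → Matrix d d ℂ) (P : X → ℝ) (M : Matrix d d ℂ) :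
    (output W P * M).trace.re = ∑ x, P x * (W x * M).trace.re := by
  simp [output, Finset.sum_mul, trace_sum, trace_smul]

lemma trace_output {W : X → Matrix d d ℂ} (hW : ∀ x, IsDensityMatrix (W x)) (P : X → ℝ) :
    (output W P).trace.re = ∑ x, P x := by
  simpa [fun x => (hW x).2] using trace_output_mul W P 1

lemma posSemidef_smul_of_nonneg {m : Type*} {r : ℝ} (hr : 0 ≤ r) {M : Matrix m m ℂ} (hM : M.PosSemidef) :
    (r • M).PosSemidef := by
  rw [← Complex.coe_smul]
  exact hM.smul (by exact_mod_cast hr)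

lemma posSemidef_output {W : X → Matrix d d ℂ} (hW : ∀ x, (W x).PosSemidef) {P : X → ℝ}
    (hP : ∀ x, 0 ≤ P x) : (output W P).PosSemidef :=
  posSemidef_sum _ fun x _ => posSemidef_smul_of_nonneg (hP x) (hW x)

/-- The nonnegative numbers `v* P(y) W_y v` sum to zero, so each vanishes. Hence inputs of positive
weight have finite divergence from the output. -/
lemma mulVec_eq_zero_of_output {W : X → Matrix d d ℂ} (hW : ∀ x, (W x).PosSemidef) {P : X → ℝ}
    (hP : ∀ x, 0 ≤ P x) {x : X} (hx : 0 < P x) {v : d → ℂ} (hv : output W P *ᵥ v = 0) :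
    W x *ᵥ v = 0 := by
  have hsum : ∑ y, star v ⬝ᵥ ((P y • W y) *ᵥ v) = 0 := by
    rw [← dotProduct_sum, ← sum_mulVec]
    change star v ⬝ᵥ (output W P *ᵥ v) = 0
    rw [hv, dotProduct_zero]
  have hpsd := fun y => posSemidef_smul_of_nonneg (hP y) (hW y)
  have h0 := (Finset.sum_eq_zero_iff_of_nonneg
    fun y _ => (hpsd y).dotProduct_mulVec_nonneg v).mp hsum x (Finset.mem_univ x)
  have h1 := ((hpsd x).dotProduct_mulVec_zero_iff v).mp h0
  rw [smul_mulVec] at h1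
  exact (smul_eq_zero.mp h1).resolve_left hx.ne'

lemma holevoInformation_eq {W : X → Matrix d d ℂ} (hW : ∀ x, (W x).PosSemidef) {P : X → ℝ}
    (hP : ∀ x, 0 ≤ P x) :
    holevoInformation W P =
      ((∑ x, P x * (W x * (matLog (W x) - matLog (output W P))).trace.re : ℝ) : EReal) := by
  rw [holevoInformation, coe_sum]
  refine Finset.sum_congr rfl fun x _ => ?_
  rw [EReal.coe_mul]
  rcases (hP x).eq_or_lt with h | h
  · simp [← h]
  · rw [relEntropy_of_ker_le fun v => mulVec_eq_zero_of_output hW hP h]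

/-- The mean divergence to any positive definite state bounds the Holevo information. -/
lemma holevoInformation_le {W : X → Matrix d d ℂ} (hW : ∀ x, IsDensityMatrix (W x)) {P : X → ℝ}
    (hP : P ∈ stdSimplex ℝ X) {ρ : Matrix d d ℂ} (hρ : ρ.PosDef) (htr : ρ.trace = 1) {C : ℝ}
    (hC : ∀ x, relEntropy (W x) ρ = (C : EReal)) : holevoInformation W P ≤ C := by
  have hW' := fun x => (hW x).1
  have hC' : ∀ x, (W x * (matLog (W x) - matLog ρ)).trace.re = C := fun x =>
    EReal.coe_injective ((relEntropy_of_posDef (W x) hρ).symm.trans (hC x))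
  have hK := trace_sub_trace_le_trace_mul_matLog_sub (posSemidef_output hW' hP.1) hρ
  rw [trace_output hW, hP.2, htr, trace_output_mul] at hK
  rw [holevoInformation_eq hW' hP.1, EReal.coe_le_coe_iff]
  -- The subtracted sum is `D(W_P‖ρ)`, nonnegative by `hK` since both traces are one.
  calc ∑ x, P x * (W x * (matLog (W x) - matLog (output W P))).trace.re
      = ∑ x, P x * (W x * (matLog (W x) - matLog ρ)).trace.re -
          ∑ x, P x * (W x * (matLog (output W P) - matLog ρ)).trace.re := by
        rw [← Finset.sum_sub_distrib]
        refine Finset.sum_congr rfl fun x _ => ?_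
        rw [← mul_sub, ← Complex.sub_re, ← trace_sub, ← mul_sub, sub_sub_sub_cancel_right]
    _ ≤ ∑ x, P x * C := by
        simp_rw [hC']
        simp only [Complex.one_re, sub_self] at hK
        linarith
    _ = C := by rw [← Finset.sum_mul, hP.2, one_mul]

/-- If the divergences `D(W_x‖ρ)` are all equal to `C` and `ρ` is the output of a distribution
`Q`, then `Q` attains the capacity, which is `C`. -/
lemma capacity_eq {W : X → Matrix d d ℂ} (hW : ∀ x, IsDensityMatrix (W x)) {Q : X → ℝ}
    (hQ : Q ∈ stdSimplex ℝ X) (hρ : (output W Q).PosDef) (htr : (output W Q).trace = 1) {C : ℝ}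
    (hC : ∀ x, relEntropy (W x) (output W Q) = (C : EReal)) :
    holevoInformation W Q = capacity W ∧ capacity W = (C : EReal) := by
  have hQC : holevoInformation W Q = (C : EReal) := by
    simp_rw [holevoInformation, hC, ← EReal.coe_mul, ← coe_sum]
    rw [← Finset.sum_mul, hQ.2, one_mul]
  have hcap : capacity W = (C : EReal) := by
    refine le_antisymm (sSup_le ?_) (hQC ▸ le_sSup ⟨Q, hQ, rfl⟩)
    rintro _ ⟨P, hP, rfl⟩
    exact holevoInformation_le hW hP hρ htr hC
  exact ⟨hQC.trans hcap.symm, hcap⟩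

end Holevo

section Gibbs

variable {J : Type*} [Fintype J] {A : J → Matrix d d ℂ}

lemma isHermitian_real_smul {m : Type*} (r : ℝ) {M : Matrix m m ℂ} (hM : M.IsHermitian) :
    (r • M).IsHermitian := by
  rw [IsHermitian, conjTranspose_smul, hM.eq, star_trivial]

lemma isHermitian_sum_smul (hA : ∀ j, (A j).IsHermitian) (θ : J → ℝ) :
    (∑ j, θ j • A j).IsHermitian := by
  rw [IsHermitian, conjTranspose_sum]
  exact Finset.sum_congr rfl fun j _ => isHermitian_real_smul _ (hA j)

lemma isHermitian_gibbs_exponent (hA : ∀ j, (A j).IsHermitian) (θ : J → ℝ) :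
    (∑ j, θ j • A j - phi A θ • (1 : Matrix d d ℂ)).IsHermitian :=
  (isHermitian_sum_smul hA θ).sub (isHermitian_real_smul _ isHermitian_one)

lemma posDef_gibbs (hA : ∀ j, (A j).IsHermitian) (θ : J → ℝ) : (gibbs A θ).PosDef :=
  posDef_exp (isHermitian_gibbs_exponent hA θ)

lemma matLog_gibbs (hA : ∀ j, (A j).IsHermitian) (θ : J → ℝ) :
    matLog (gibbs A θ) = ∑ j, θ j • A j - phi A θ • (1 : Matrix d d ℂ) :=
  matLog_exp (isHermitian_gibbs_exponent hA θ)

lemma exp_sub_smul_one (H : Matrix d d ℂ) (r : ℝ) :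
    NormedSpace.exp (H - r • (1 : Matrix d d ℂ)) = (Real.exp (-r)) • NormedSpace.exp H := by
  have h : NormedSpace.exp ((-r) • (1 : Matrix d d ℂ)) = Real.exp (-r) • (1 : Matrix d d ℂ) := by
    have h1 : (-r) • (1 : Matrix d d ℂ) = diagonal fun _ => ((-r : ℝ) : ℂ) := by
      ext i j; simp [one_apply, diagonal_apply]
    have h2 : Real.exp (-r) • (1 : Matrix d d ℂ) = diagonal fun _ => ((Real.exp (-r) : ℝ) : ℂ) := by
      ext i j; simp [one_apply, diagonal_apply]
    rw [h1, h2, exp_diagonal]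
    congr 1
    funext i
    rw [Pi.coe_exp, ← Complex.exp_eq_exp_ℂ, Complex.ofReal_exp]
  rw [sub_eq_add_neg, ← neg_smul,
    exp_add_of_commute _ _ ((Commute.one_right H).smul_right _), h, mul_smul_comm, mul_one]

/-- Positive definiteness makes `Tr exp` a positive real, so `Real.exp` undoes the logarithm in
`phi`. -/
lemma trace_gibbs [Nonempty d] (hA : ∀ j, (A j).IsHermitian) (θ : J → ℝ) :
    (gibbs A θ).trace = 1 := by
  have hpos := (posDef_exp (isHermitian_sum_smul hA θ)).trace_pos
  obtain ⟨hre, him⟩ := Complex.pos_iff.mp hpos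
  rw [gibbs, exp_sub_smul_one, trace_smul, Real.exp_neg, phi, Real.exp_log hre]
  apply Complex.ext
  · simp [inv_mul_cancel₀ hre.ne']
  · simp [← him]

lemma isDensityMatrix_gibbs [Nonempty d] (hA : ∀ j, (A j).IsHermitian) (θ : J → ℝ) :
    IsDensityMatrix (gibbs A θ) :=
  ⟨(posDef_gibbs hA θ).posSemidef, trace_gibbs hA θ⟩

lemma relEntropy_gibbs {ρ : Matrix d d ℂ} (hρ : IsDensityMatrix ρ) (hA : ∀ j, (A j).IsHermitian)
    (θ : J → ℝ) :
    relEntropy ρ (gibbs A θ) =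
      ((phi A θ - entropy ρ - (∑ j, (ρ * A j).trace * (θ j : ℂ)).re : ℝ) : EReal) := by
  rw [relEntropy_of_posDef _ (posDef_gibbs hA θ), matLog_gibbs hA]
  congr 1
  have h : (ρ * ∑ j, θ j • A j).trace = ∑ j, (ρ * A j).trace * (θ j : ℂ) := by
    simp_rw [Finset.mul_sum, trace_sum, mul_smul_comm, trace_smul, Complex.real_smul, mul_comm]
  rw [mul_sub, mul_sub, trace_sub, trace_sub, h, mul_smul_comm, mul_one, trace_smul, hρ.2,
    entropy]
  simp only [Complex.sub_re, Complex.real_smul, mul_one, Complex.ofReal_re]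
  ring

end Gibbs

end

end CQ

theorem theorem5 (n : ℕ) (hn : 0 < n)
    (W : Fin (n ^ 2) → Matrix (Fin n) (Fin n) ℂ)
    (hW : ∀ x, CQ.IsDensityMatrix (W x))
    (hWind : LinearIndependent ℝ W)
    (A : Fin (n ^ 2 - 1) → Matrix (Fin n) (Fin n) ℂ)
    (hA : ∀ j, (A j).IsHermitian)
    (hAind : LinearIndependent ℝ A)
    (hA0 : ∀ j, (W (CQ.lastInput n hn) * A j).trace = 0)
    (θ : Fin (n ^ 2 - 1) → ℝ)
    (hθ : ∀ i, ∑ j, (W i * A j).trace * (θ j : ℂ) =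
      ((-CQ.entropy (W i) + CQ.entropy (W (CQ.lastInput n hn)) : ℝ) : ℂ)) :
    CQ.IsDensityMatrix (CQ.gibbs A θ) ∧
    (∀ x, CQ.relEntropy (W x) (CQ.gibbs A θ) =
      ((CQ.phi A θ - CQ.entropy (W (CQ.lastInput n hn)) : ℝ) : EReal)) ∧
    ∃ Q : Fin (n ^ 2) → ℝ,
      (∀ Q' : Fin (n ^ 2) → ℝ, CQ.output W Q' = CQ.gibbs A θ ↔ Q' = Q) ∧
      ((∀ x, 0 ≤ Q x) →
        Q ∈ stdSimplex ℝ (Fin (n ^ 2)) ∧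
        CQ.holevoInformation W Q = CQ.capacity W ∧
        CQ.capacity W =
          ((CQ.phi A θ - CQ.entropy (W (CQ.lastInput n hn)) : ℝ) : EReal)) := by
  have : Nonempty (Fin n) := ⟨⟨0, hn⟩⟩
  have hpd := CQ.posDef_gibbs hA θ
  have hρ := CQ.isDensityMatrix_gibbs hA θ
  have htr := hρ.2
  have hD : ∀ x, CQ.relEntropy (W x) (CQ.gibbs A θ) =
      ((CQ.phi A θ - CQ.entropy (W (CQ.lastInput n hn)) : ℝ) : EReal) := fun x => by
    rw [CQ.relEntropy_gibbs (hW x) hA, hθ x, Complex.ofReal_re]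
    congr 1
    ring
  obtain ⟨Q, hQ⟩ := CQ.exists_output_eq (fun x => (hW x).isHermitian) hWind (by simp)
    hρ.isHermitian
  refine ⟨hρ, hD, Q, fun Q' => ?_, fun hQ0 => ?_⟩
  · rw [← hQ, (CQ.output_injective hWind).eq_iff]
  · have hmem : Q ∈ stdSimplex ℝ (Fin (n ^ 2)) :=
      -- Normalization of `Q` is automatic: every `W_x` and the Gibbs state have trace one.
      ⟨hQ0, by rw [← CQ.trace_output hW, hQ, htr, Complex.one_re]⟩
    rw [← hQ] at hpd htr hD
    exact ⟨hmem, CQ.capacity_eq hW hmem hpd htr hD⟩
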